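/- **Setting.** Let $\mathbb P,\mathbb Q$ be probability measures on a measurable space $\mathcal X$ and let $\varepsilon\ge 0$. A randomized algorithm $\mathcal M$ is $\varepsilon$-DP if $\Pr[\mathcal M(x)\in S]\le e^{\varepsilon}\Pr[\mathcal M(x')\in S]$ for all datasets $x,x'$ differing in one entry and all events $S$. An $\varepsilon$-DP e-variable for $\mathbb P$ on $n$ data points is a non-negative random variable $E=\mathcal M(X_1,\dots,X_n)$ with $\mathcal M$ $\varepsilon$-DP and $\mathbb E^{\mathbb P^n}[E]\le 1$, where expectations are over the i.i.d. data and the internal randomness of $\mathcal M$. The optimal rate is $$R_\varepsilon(\mathbb Q\Vert\mathbb P)=\lim_{n\to\infty}\ \sup_{E\ \varepsilon\text{-DP e-variable for }\mathbb P\text{ on } n\text{ points}}\ \frac{\mathbb E^{\mathbb Q^n}[\log E]}{n}.$$ An $\varepsilon$-DP sequential test is an $\varepsilon$-DP randomized algorithm $\mathcal M$ that reads a stream $x_1,x_2,\dots$ in $\mathcal X$ and outputs decisions $\phi_t\in\{0,1\}$ ($\phi_t=1$: the null is rejected) together with a stopping time $N$, such that, for every $t$, the law of what is observed up to time $t$ (the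 decisions up to time $t$, whether $N\le t$, and the value of $N$ if $N\le t$) depends only on $x_{1:t}$. Its level is $\alpha:=\mathbb P(\phi_N=1)$ and its power is $1-\beta:=\mathbb Q(\phi_N=1)$, for i.i.d. streams from $\mathbb P$ and $\mathbb Q$ respectively. **Proposition.** The limit $R_\varepsilon(\mathbb Q\Vert\mathbb P)$ exists and lies in $[0,\infty)$. Let $\mathcal M$ be any $\varepsilon$-DP sequential test with level $\alpha$, power $1-\beta$, and stopping time $N<N_{\max}$ almost surely for some constant $N_{\max}<\infty$. Then $$\mathbb E^{\mathbb Q}[N]\cdot R_\varepsilon(\mathbb Q\Vert\mathbb P)\ \ge\ (1-\beta)\log\frac{1-\beta}{\alpha}+\beta\log\frac{\beta}{1-\alpha},$$ that is, $$\mathbb E^{\mathbb Q}[N]\ \ge\ \frac{(1-\beta)\log\frac{1-\beta}{\alpha}+\beta\log\frac{\beta}{1-\alpha}}{R_\varepsilon(\mathbb Q\Vert\mathbb P)}.$$ Conventions: $0\log(0/c)=0$ for every $c\ge 0$, and the quotient is read as $0$ when $R_\varepsilon(\mathbb Q\Vert\mathbb P)=0$. -/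

import Mathlib

open MeasureTheory ProbabilityTheory Filter Topology
open scoped ENNReal NNReal

namespace DPTest

/-- Two datasets indexed by `ι` (finite samples for `ι = Fin n`, streams for `ι = ℕ`) that differ
in at most one entry. -/
def Neighbors {ι X : Type*} (x x' : ι → X) : Prop :=
  ∃ i, ∀ j, j ≠ i → x j = x' j

/-- A randomized algorithm, i.e. a Markov kernel from datasets to outputs, is `ε`-differentially
private: `Pr[M(x) ∈ S] ≤ e^ε Pr[M(x') ∈ S]` for all neighboring datasets and all events. -/
def IsDP {ι X O : Type*} [MeasurableSpace X] [MeasurableSpace O]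
    (ε : ℝ) (M : Kernel (ι → X) O) : Prop :=
  ∀ x x' : ι → X, Neighbors x x' → ∀ S : Set O, MeasurableSet S →
    M x S ≤ ENNReal.ofReal (Real.exp ε) * M x' S

/-- The law `M(P^n)` of the output of `M` on an i.i.d. sample of `n` points from `P`. -/
noncomputable def batchLaw {X O : Type*} [MeasurableSpace X] [MeasurableSpace O]
    {n : ℕ} (M : Kernel (Fin n → X) O) (P : Measure X) : Measure O :=
  (Measure.pi fun _ : Fin n => P).bind M

/-- The law `M(P^ℕ)` of the output of `M` on an i.i.d. stream of points from `P`. -/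
noncomputable def streamLaw {X O : Type*} [MeasurableSpace X] [MeasurableSpace O]
    (M : Kernel (ℕ → X) O) (P : Measure X) : Measure O :=
  (Measure.infinitePi fun _ : ℕ => P).bind M

/-- `M` is (the mechanism of) an `ε`-DP e-variable for `P` based on `n` data points: `M` is a
randomized algorithm with nonnegative output, it is `ε`-DP, and the mean of its output on an i.i.d.
sample from `P` is at most `1`. -/
structure IsDPEVariable {X : Type*} [MeasurableSpace X] {n : ℕ}
    (ε : ℝ) (P : Measure X) (M : Kernel (Fin n → X) ℝ≥0) : Prop where
  markov : IsMarkovKernel M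
  dp : IsDP ε M
  mean_le_one : ∫⁻ y, (y : ℝ≥0∞) ∂(batchLaw M P) ≤ 1

/-- The expectation of `log Y` for `Y ∼ μ`, as positive part minus negative part, in `[-∞, ∞]`,
with `log 0 = -∞`. -/
noncomputable def expectedLog (μ : Measure ℝ≥0) : EReal :=
  ((∫⁻ y, (ENNReal.log (y : ℝ≥0∞)).toENNReal ∂μ : ℝ≥0∞) : EReal) -
    ((∫⁻ y, (-ENNReal.log (y : ℝ≥0∞)).toENNReal ∂μ : ℝ≥0∞) : EReal)

/-- The optimal e-power per data point with `n` data points: the supremum, over all `ε`-DP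
e-variables `E` for `P`, of `E^{Q^n}[log E] / n`. -/
noncomputable def batchRate {X : Type*} [MeasurableSpace X]
    (ε : ℝ) (Q P : Measure X) (n : ℕ) : EReal :=
  ⨆ (M : Kernel (Fin n → X) ℝ≥0) (_ : IsDPEVariable ε P M),
    expectedLog (batchLaw M Q) / ((n : ℝ) : EReal)

/-- The output of a sequential test is a pair `ω = (φ, N)`: the decisions `φ 0, φ 1, φ 2, …`, where
`φ t` is the decision after `t` data points (`true` means that the null has been rejected), and the
stopping time `N`. What has been observed up to time `t` is `φ 0, …, φ t`, whether
`N ≤ t`, and the value of `N` if `N ≤ t`. -/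
def observed (t : ℕ) (ω : (ℕ → Bool) × ℕ) : (Fin (t + 1) → Bool) × ℕ :=
  (fun i => ω.1 i, min ω.2 (t + 1))

/-- The event that the final decision is to reject the null, `φ N = 1`. -/
def rejects : Set ((ℕ → Bool) × ℕ) := {ω | ω.1 ω.2 = true}

/-- An `ε`-DP sequential test: a randomized algorithm that reads a stream of data points
(`x_1 = x 0`, `x_2 = x 1`, …) and releases decisions and a stopping time, that is `ε`-DP, and for
which what is observed up to time `t` depends only on the first `t` data points. -/
structure IsDPSequentialTest {X : Type*} [MeasurableSpace X]
    (ε : ℝ) (M : Kernel (ℕ → X) ((ℕ → Bool) × ℕ)) : Prop where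
  markov : IsMarkovKernel M
  dp : IsDP ε M
  causal : ∀ (t : ℕ) (x x' : ℕ → X), (∀ i, i < t → x i = x' i) →
    (M x).map (observed t) = (M x').map (observed t)

theorem measurable_observed (t : ℕ) : Measurable (observed t) := by
  unfold observed
  fun_prop

end DPTest

/-! Let `a n` be the supremum of the expected log under `Q` over `ε`-DP e-variables on `n` points
(`optLog`). Running mechanisms on disjoint blocks of data and multiplying their outputs costs no
extra privacy, because each data point enters only one factor. Hence `a` is superadditive. Group
privacy and Jensen give `a n ≤ n * ε`, so Fekete's lemma yields a finite limit `R` of `a n / n`.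

A test enters as a bet. Pay out the likelihood ratio of its final decision, then spend the points
left after the stopping time on a near-optimal e-variable. Causality makes the event of stopping at
`k` a function of the first `k` points, so the product is again an `ε`-DP e-variable. Its expected
log gives `D + ∑ q k * a (n - k) ≤ a n`, where `q` is the law of the stopping time under `Q` and `D`
is the divergence of the two decision laws (`le_optLog_of_stages`, `renewal_le`). Since `a` grows at
rate `R`, this renewal inequality forces `D ≤ E[N] * R` (`le_mul_of_renewal`). -/

namespace DPTest

/-! ### Group privacy -/

theorem isDP_iff_le {X O ι : Type*} [MeasurableSpace X] [MeasurableSpace O]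
    {ε : ℝ} {M : Kernel (ι → X) O} :
    IsDP ε M ↔ ∀ x x' : ι → X, Neighbors x x' → M x ≤ ENNReal.ofReal (Real.exp ε) • M x' := by
  simp only [IsDP, Measure.le_iff, Measure.smul_apply, smul_eq_mul]

theorem isDP_const {X O ι : Type*} [MeasurableSpace X] [MeasurableSpace O]
    {ε : ℝ} (hε : 0 ≤ ε) (μ : Measure O) : IsDP ε (Kernel.const (ι → X) μ) := by
  intro x x' _ S _
  simp only [Kernel.const_apply]
  exact le_mul_of_one_le_left zero_le (by simpa using hε)

/-- Group privacy for datasets that agree outside the first `k` entries. -/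
theorem IsDP.le_pow_of_agree {X O : Type*} [MeasurableSpace X] [MeasurableSpace O]
    {n : ℕ} {ε : ℝ} {M : Kernel (Fin n → X) O} (hM : IsDP ε M)
    (x' : Fin n → X) (k : ℕ) (hk : k ≤ n) (x : Fin n → X) (h : ∀ i : Fin n, k ≤ i → x i = x' i) :
    M x ≤ ENNReal.ofReal (Real.exp ε) ^ k • M x' := by
  induction k generalizing x with
  | zero =>
    have : x = x' := funext fun i => h i (Nat.zero_le _)
    simp [this]
  | succ k ih =>
    set y := Function.update x ⟨k, hk⟩ (x' ⟨k, hk⟩) with hy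
    have hxy : Neighbors x y := ⟨⟨k, hk⟩, fun j hj => by simp [hy, hj]⟩
    have h2 := ih (Nat.le_of_succ_le hk) y fun i hi => by
      by_cases hik : i = ⟨k, hk⟩
      · simp [hy, hik]
      · have : k + 1 ≤ i := lt_of_le_of_ne hi fun e => hik (Fin.ext e.symm)
        simp [hy, hik, h i this]
    refine Measure.le_iff.2 fun S hS => ?_
    calc M x S ≤ _ := hM x y hxy S hS
      _ ≤ _ := mul_le_mul_right (h2 S) _
      _ = _ := by
        simp only [Measure.smul_apply, smul_eq_mul, pow_succ', mul_assoc]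

/-- Any two samples are at most `n` replacements apart, so the group privacy bound holds for every
pair; it is then averaged over both samples. No relation between `P` and `Q` is needed. -/
theorem IsDP.batchLaw_le {X O : Type*} [MeasurableSpace X] [MeasurableSpace O]
    {n : ℕ} {ε : ℝ} {M : Kernel (Fin n → X) O} (hM : IsDP ε M) (P Q : Measure X)
    [IsProbabilityMeasure P] [IsProbabilityMeasure Q] :
    batchLaw M Q ≤ ENNReal.ofReal (Real.exp ε) ^ n • batchLaw M P := by
  have hc : ENNReal.ofReal (Real.exp ε) ^ n ≠ ∞ := by finiteness
  refine Measure.le_iff.2 fun S hS => ?_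
  have h1 (x x') : M x S ≤ ENNReal.ofReal (Real.exp ε) ^ n * M x' S :=
    hM.le_pow_of_agree x' n le_rfl x (fun i hi => absurd i.2 (by omega)) S
  have h2 (x) : M x S ≤ ENNReal.ofReal (Real.exp ε) ^ n * batchLaw M P S := by
    rw [batchLaw, Measure.bind_apply hS M.aemeasurable, ← lintegral_const_mul' _ _ hc]
    calc M x S = ∫⁻ _, M x S ∂(Measure.pi fun _ : Fin n => P) := by simp
      _ ≤ _ := lintegral_mono (h1 x)
  rw [batchLaw, Measure.bind_apply hS M.aemeasurable]
  calc _ ≤ ∫⁻ _, ENNReal.ofReal (Real.exp ε) ^ n * batchLaw M P S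
          ∂(Measure.pi fun _ : Fin n => Q) := lintegral_mono h2
    _ = _ := by simp

/-! ### Cutting a sample in two -/

/-- The index set of a sample of `n` points, cut after the first `k` points. -/
def cutEquiv {n : ℕ} (k : Fin (n + 1)) : Fin k ⊕ Fin (n - k) ≃ Fin n :=
  finSumFinEquiv.trans (finCongr (by omega))

/-- The first `k` points of a sample, and the others. -/
def cut {X : Type*} {n : ℕ} (k : Fin (n + 1)) (x : Fin n → X) :
    (Fin k → X) × (Fin (n - k) → X) :=
  (fun i => x (cutEquiv k (.inl i)), fun j => x (cutEquiv k (.inr j)))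

theorem cutEquiv_inl {n : ℕ} (k : Fin (n + 1)) (i : Fin k) :
    ((cutEquiv k (.inl i) : Fin n) : ℕ) = i := by
  simp [cutEquiv]

theorem measurable_cut {X : Type*} [MeasurableSpace X] {n : ℕ} (k : Fin (n + 1)) :
    Measurable (cut k : (Fin n → X) → _) := by
  unfold cut
  fun_prop

theorem map_cut_pi {X : Type*} [MeasurableSpace X] (P : Measure X) [IsProbabilityMeasure P]
    {n : ℕ} (k : Fin (n + 1)) :
    (Measure.pi fun _ : Fin n => P).map (cut k) =
      (Measure.pi fun _ : Fin k => P).prod (Measure.pi fun _ : Fin (n - k) => P) := by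
  have h1 := (measurePreserving_piCongrLeft (fun _ : Fin n => P) (cutEquiv k)).symm
  have h2 := measurePreserving_sumPiEquivProdPi
    (fun _ : Fin k ⊕ Fin (n - k) => P)
  exact (h2.comp h1).map_eq

/-- Neighboring samples agree before the cut and are neighbors after it, or the other way round. -/
theorem Neighbors.cut {X : Type*} {n : ℕ} {x x' : Fin n → X} (h : Neighbors x x')
    (k : Fin (n + 1)) :
    ((cut k x).1 = (cut k x').1 ∧ Neighbors (cut k x).2 (cut k x').2) ∨
      (Neighbors (cut k x).1 (cut k x').1 ∧ (cut k x).2 = (cut k x').2) := by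
  obtain ⟨i, hi⟩ := h
  rcases hs : (cutEquiv k).symm i with a | a
  · rw [Equiv.symm_apply_eq] at hs
    subst hs
    exact .inr ⟨⟨a, fun j hj => hi _ (by simpa using hj)⟩, funext fun j => hi _ (by simp)⟩
  · rw [Equiv.symm_apply_eq] at hs
    subst hs
    exact .inl ⟨funext fun j => hi _ (by simp), ⟨a, fun j hj => hi _ (by simpa using hj)⟩⟩

/-! ### Sequential composition -/

/-- Run one of the stages `W k` on the first `k` points of the sample, run `M k` on the
remaining points, and release the product of the outputs. Here `k ≤ n` is random, and the total
mass of `W k` is the conditional probability of `k`. -/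
noncomputable def compose {X : Type*} [MeasurableSpace X] {n : ℕ}
    (W : ∀ k : Fin (n + 1), Kernel (Fin k → X) ℝ≥0)
    (M : ∀ k : Fin (n + 1), Kernel (Fin (n - k) → X) ℝ≥0) : Kernel (Fin n → X) ℝ≥0 :=
  ∑ k, ((W k ∥ₖ M k).comap (cut k) (measurable_cut k)).map fun p => p.1 * p.2

section Compose

variable {X : Type*} [MeasurableSpace X] {n : ℕ}
  (W : ∀ k : Fin (n + 1), Kernel (Fin k → X) ℝ≥0)
  (M : ∀ k : Fin (n + 1), Kernel (Fin (n - k) → X) ℝ≥0)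
  [∀ k, IsFiniteKernel (W k)] [∀ k, IsMarkovKernel (M k)]

theorem compose_apply (x : Fin n → X) :
    compose W M x =
      ∑ k, ((W k (cut k x).1).prod (M k (cut k x).2)).map fun p => p.1 * p.2 := by
  simp only [compose, _root_.sum_apply]
  refine Finset.sum_congr rfl fun k _ => ?_
  rw [Kernel.map_apply _ (by fun_prop), Kernel.comap_apply, Kernel.parallelComp_apply]

theorem isMarkovKernel_compose (hW : ∀ x : Fin n → X, ∑ k, W k (cut k x).1 Set.univ = 1) :
    IsMarkovKernel (compose W M) := by
  refine ⟨fun x => ⟨?_⟩⟩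
  rw [compose_apply, Measure.finsetSum_apply, ← hW x]
  refine Finset.sum_congr rfl fun k _ => ?_
  rw [Measure.map_apply (by fun_prop) .univ, Set.preimage_univ, Measure.prod_apply .univ]
  simp

/-- For each fixed `k` a changed entry lies on one side of the cut, so only one of the two factors
changes and the factor `e^ε` is paid once. Summing over `k` keeps the constant. -/
theorem isDP_compose {ε : ℝ} (hW : ∀ k, IsDP ε (W k)) (hM : ∀ k, IsDP ε (M k)) :
    IsDP ε (compose W M) := by
  rw [isDP_iff_le]
  intro x x' hx
  rw [compose_apply, compose_apply, Finset.smul_sum]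
  refine Finset.sum_le_sum fun k _ => ?_
  rw [← Measure.map_smul]
  refine Measure.map_mono ?_ (by fun_prop)
  rcases hx.cut k with ⟨h1, h2⟩ | ⟨h1, h2⟩
  · rw [h1, ← Measure.prod_smul_right]
    exact Measure.prod_mono le_rfl (isDP_iff_le.1 (hM k) _ _ h2)
  · rw [h2, ← Measure.prod_smul_left]
    exact Measure.prod_mono (isDP_iff_le.1 (hW k) _ _ h1) le_rfl

instance {O : Type*} [MeasurableSpace O] (K : Kernel (Fin n → X) O) [IsMarkovKernel K]
    (P : Measure X) [IsProbabilityMeasure P] : IsProbabilityMeasure (batchLaw K P) := by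
  unfold batchLaw; infer_instance

instance {O : Type*} [MeasurableSpace O] (K : Kernel (Fin n → X) O) [IsFiniteKernel K]
    (P : Measure X) [IsProbabilityMeasure P] : IsFiniteMeasure (batchLaw K P) := by
  unfold batchLaw; infer_instance

/-- A discrete strong Markov property: although the cut is random, stage `k` reads only the first
`k` points, and these are independent of the remaining ones. -/
theorem batchLaw_compose (P : Measure X) [IsProbabilityMeasure P] :
    batchLaw (compose W M) P =
      ∑ k, ((batchLaw (W k) P).prod (batchLaw (M k) P)).map fun p => p.1 * p.2 := by
  ext S hS
  rw [batchLaw, Measure.bind_apply hS (Kernel.aemeasurable _), Measure.finsetSum_apply]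
  simp_rw [compose_apply, Measure.finsetSum_apply]
  have hmeas (k : Fin (n + 1)) : Measurable fun p : (Fin k → X) × (Fin (n - k) → X) =>
      (((W k p.1).prod (M k p.2)).map fun p => p.1 * p.2) S := by
    have := ((W k ∥ₖ M k).map fun p => p.1 * p.2).measurable_coe hS
    have he (p) : ((W k ∥ₖ M k).map fun p => p.1 * p.2) p =
        ((W k p.1).prod (M k p.2)).map fun p => p.1 * p.2 := by
      rw [Kernel.map_apply _ (by fun_prop), Kernel.parallelComp_apply]
    simpa only [he] using this
  refine (lintegral_finsetSum _ fun k _ => (hmeas k).comp (measurable_cut k)).trans ?_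
  refine Finset.sum_congr rfl fun k _ => ?_
  refine (lintegral_map (hmeas k) (measurable_cut k)).symm.trans ?_
  rw [map_cut_pi]
  have h : (batchLaw (W k) P).prod (batchLaw (M k) P) =
      ((Measure.pi fun _ : Fin k => P).prod (Measure.pi fun _ : Fin (n - k) => P)).bind
        (W k ∥ₖ M k) := by
    refine Measure.prod_eq fun s t hs ht => ?_
    rw [Measure.bind_apply (hs.prod ht) (Kernel.aemeasurable _)]
    simp_rw [Kernel.parallelComp_apply, Measure.prod_prod]
    rw [lintegral_prod_mul (f := fun a => W k a s) (g := fun b => M k b t)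
        ((W k).measurable_coe hs).aemeasurable ((M k).measurable_coe ht).aemeasurable,
      batchLaw, batchLaw, Measure.bind_apply hs (Kernel.aemeasurable _),
      Measure.bind_apply ht (Kernel.aemeasurable _)]
  rw [h, Measure.map_apply (by fun_prop) hS, Measure.bind_apply
    (measurableSet_preimage (by fun_prop) hS) (Kernel.aemeasurable _)]
  refine lintegral_congr fun p => ?_
  rw [Kernel.parallelComp_apply, Measure.map_apply (by fun_prop) hS]

theorem lintegral_batchLaw_compose_le (P : Measure X) [IsProbabilityMeasure P]
    (hM : ∀ k, ∫⁻ y, (y : ℝ≥0∞) ∂(batchLaw (M k) P) ≤ 1) :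
    ∫⁻ y, (y : ℝ≥0∞) ∂(batchLaw (compose W M) P) ≤
      ∑ k, ∫⁻ y, (y : ℝ≥0∞) ∂(batchLaw (W k) P) := by
  rw [batchLaw_compose, lintegral_finsetSum_measure]
  refine Finset.sum_le_sum fun k _ => ?_
  rw [lintegral_map (by fun_prop) (by fun_prop)]
  simp_rw [ENNReal.coe_mul]
  rw [lintegral_prod_mul (f := fun y : ℝ≥0 => (y : ℝ≥0∞)) (g := fun y : ℝ≥0 => (y : ℝ≥0∞))
    (by fun_prop) (by fun_prop)]
  exact mul_le_of_le_one_right' (hM k)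

end Compose

/-! ### Expected logarithms -/

/-- The logarithm of `Y ∼ μ` is almost surely finite and it is integrable. -/
structure HasLog (μ : Measure ℝ≥0) : Prop where
  ae_ne_zero : ∀ᵐ y ∂μ, y ≠ 0
  integrable : Integrable (fun y : ℝ≥0 => Real.log y) μ

theorem toENNReal_log_coe (y : ℝ≥0) :
    (ENNReal.log (y : ℝ≥0∞)).toENNReal = ENNReal.ofReal (Real.log y) := by
  by_cases hy : y = 0
  · simp [hy]
  · rw [ENNReal.log_of_nnreal hy, EReal.real_coe_toENNReal]

theorem toENNReal_neg_log_coe {y : ℝ≥0} (hy : y ≠ 0) :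
    (-ENNReal.log (y : ℝ≥0∞)).toENNReal = ENNReal.ofReal (-Real.log y) := by
  rw [ENNReal.log_of_nnreal hy, ← EReal.coe_neg, EReal.real_coe_toENNReal]

theorem measurable_log_coe : Measurable fun y : ℝ≥0 => Real.log y :=
  Real.measurable_log.comp measurable_coe_nnreal_real

theorem HasLog.expectedLog_eq {μ : Measure ℝ≥0} (h : HasLog μ) :
    expectedLog μ = ((∫ y : ℝ≥0, Real.log y ∂μ : ℝ) : EReal) := by
  have h2 : ∫⁻ y, (-ENNReal.log (y : ℝ≥0∞)).toENNReal ∂μ =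
      ∫⁻ y : ℝ≥0, ENNReal.ofReal (-Real.log y) ∂μ :=
    lintegral_congr_ae (h.ae_ne_zero.mono fun y hy => toENNReal_neg_log_coe hy)
  have hp := h.integrable.lintegral_lt_top
  have hn := h.integrable.neg.lintegral_lt_top
  simp only [Pi.neg_apply] at hn
  simp only [expectedLog, toENNReal_log_coe, h2]
  rw [integral_eq_lintegral_pos_part_sub_lintegral_neg_part h.integrable, EReal.coe_sub,
    EReal.coe_ennreal_toReal hp.ne, EReal.coe_ennreal_toReal hn.ne]

theorem lintegral_pos_log_le (μ : Measure ℝ≥0) :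
    ∫⁻ y : ℝ≥0, ENNReal.ofReal (Real.log y) ∂μ ≤ ∫⁻ y, (y : ℝ≥0∞) ∂μ := by
  refine lintegral_mono fun y => ?_
  rw [← ENNReal.ofReal_coe_nnreal]
  exact ENNReal.ofReal_le_ofReal (Real.log_le_self y.2)

/-- A finite mean bounds the positive part of the logarithm, so only the negative part can diverge.
Mechanisms of the second kind do not affect a supremum that is at least `0`. -/
theorem hasLog_or_expectedLog_eq_bot {μ : Measure ℝ≥0} (h : ∫⁻ y, (y : ℝ≥0∞) ∂μ ≠ ∞) :
    HasLog μ ∨ expectedLog μ = ⊥ := by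
  have hp : ∫⁻ y : ℝ≥0, ENNReal.ofReal (Real.log y) ∂μ ≠ ∞ :=
    ne_top_of_le_ne_top h (lintegral_pos_log_le μ)
  by_cases hn : ∫⁻ y, (-ENNReal.log (y : ℝ≥0∞)).toENNReal ∂μ = ∞
  · right
    simp only [expectedLog, toENNReal_log_coe, hn]
    rw [EReal.coe_ennreal_top, EReal.sub_top]
  · left
    have hm : Measurable fun y : ℝ≥0 => (-ENNReal.log (y : ℝ≥0∞)).toENNReal := by fun_prop
    have h0 : ∀ᵐ y : ℝ≥0 ∂μ, y ≠ 0 := by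
      filter_upwards [ae_lt_top hm hn] with y hy h0
      simp [h0] at hy
    refine ⟨h0, ?_⟩
    have hn' : ∫⁻ y : ℝ≥0, ENNReal.ofReal (-Real.log y) ∂μ ≠ ∞ := by
      rwa [← lintegral_congr_ae (h0.mono fun y hy => toENNReal_neg_log_coe hy)]
    refine ⟨measurable_log_coe.aestronglyMeasurable, ?_⟩
    rw [hasFiniteIntegral_iff_norm]
    have (y : ℝ≥0) : ENNReal.ofReal ‖Real.log y‖ ≤
        ENNReal.ofReal (Real.log y) + ENNReal.ofReal (-Real.log y) := by
      rcases le_total 0 (Real.log y) with h | h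
      · rw [Real.norm_of_nonneg h]; exact le_self_add
      · rw [Real.norm_of_nonpos h]; exact le_add_self
    refine (lintegral_mono this).trans_lt ?_
    rw [lintegral_add_left measurable_log_coe.ennreal_ofReal]
    exact ENNReal.add_lt_top.2 ⟨hp.lt_top, hn'.lt_top⟩

/-- Jensen's inequality for the logarithm. -/
theorem HasLog.integral_le {μ : Measure ℝ≥0} [IsProbabilityMeasure μ] (h : HasLog μ) {c : ℝ}
    (hc : ∫⁻ y, (y : ℝ≥0∞) ∂μ ≤ ENNReal.ofReal (Real.exp c)) :
    ∫ y : ℝ≥0, Real.log y ∂μ ≤ c := by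
  have hfin : ∫⁻ y, (y : ℝ≥0∞) ∂μ ≠ ∞ := ne_top_of_le_ne_top ENNReal.ofReal_ne_top hc
  have hint : Integrable (fun y : ℝ≥0 => (y : ℝ)) μ := by
    have := integrable_toReal_of_lintegral_ne_top (by fun_prop) hfin
    simpa using this
  have hmean : ∫ y : ℝ≥0, (y : ℝ) ∂μ ≤ Real.exp c := by
    have := integral_toReal (μ := μ) (f := fun y : ℝ≥0 => (y : ℝ≥0∞)) (by fun_prop) (by simp)
    simp only [ENNReal.coe_toReal] at this
    rw [this]
    exact ENNReal.toReal_le_of_le_ofReal (Real.exp_pos c).le hc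
  calc ∫ y : ℝ≥0, Real.log y ∂μ ≤ ∫ y : ℝ≥0, ((y : ℝ) * Real.exp (-c) + (c - 1)) ∂μ := by
        refine integral_mono_ae h.integrable ((hint.mul_const _).add (integrable_const _)) ?_
        filter_upwards [h.ae_ne_zero] with y hy
        have hy' : (0 : ℝ) < y := by positivity
        -- The tangent line to `log` at `e^c`.
        have := Real.log_le_sub_one_of_pos (mul_pos hy' (Real.exp_pos (-c)))
        rw [Real.log_mul hy'.ne' (Real.exp_pos _).ne', Real.log_exp] at this
        linarith
    _ = (∫ y : ℝ≥0, (y : ℝ) ∂μ) * Real.exp (-c) + (c - 1) := by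
        rw [integral_add (hint.mul_const _) (integrable_const _), integral_mul_const]
        simp
    _ ≤ Real.exp c * Real.exp (-c) + (c - 1) := by gcongr
    _ = c := by rw [← Real.exp_add]; simp

/-- The logarithm of the product splits. Only `ν` has mass one: `μ` will be the law of a stage,
whose mass is the probability of stopping there and so weights the second integral. -/
theorem HasLog.map_mul {μ ν : Measure ℝ≥0} [IsFiniteMeasure μ] [IsProbabilityMeasure ν]
    (hμ : HasLog μ) (hν : HasLog ν) :
    HasLog ((μ.prod ν).map fun p => p.1 * p.2) ∧
      ∫ y : ℝ≥0, Real.log y ∂((μ.prod ν).map fun p => p.1 * p.2) =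
        ∫ y : ℝ≥0, Real.log y ∂μ + μ.real Set.univ * ∫ y : ℝ≥0, Real.log y ∂ν := by
  have hm : Measurable fun p : ℝ≥0 × ℝ≥0 => p.1 * p.2 := by fun_prop
  have h1 : ∀ᵐ p ∂(μ.prod ν), p.1 ≠ 0 := Measure.quasiMeasurePreserving_fst.ae hμ.ae_ne_zero
  have h2 : ∀ᵐ p ∂(μ.prod ν), p.2 ≠ 0 := Measure.quasiMeasurePreserving_snd.ae hν.ae_ne_zero
  have i1 : Integrable (fun p : ℝ≥0 × ℝ≥0 => Real.log p.1) (μ.prod ν) := hμ.integrable.comp_fst ν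
  have i2 : Integrable (fun p : ℝ≥0 × ℝ≥0 => Real.log p.2) (μ.prod ν) := hν.integrable.comp_snd μ
  have he : (fun p : ℝ≥0 × ℝ≥0 => Real.log ((p.1 * p.2 : ℝ≥0) : ℝ)) =ᵐ[μ.prod ν]
      fun p => Real.log p.1 + Real.log p.2 := by
    filter_upwards [h1, h2] with p h1 h2
    rw [NNReal.coe_mul, Real.log_mul (by simpa) (by simpa)]
  refine ⟨⟨?_, ?_⟩, ?_⟩
  · refine (ae_map_iff hm.aemeasurable (measurableSet_singleton 0).compl).2 ?_
    filter_upwards [h1, h2] with p h1 h2 using mul_ne_zero h1 h2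
  · rw [integrable_map_measure measurable_log_coe.aestronglyMeasurable hm.aemeasurable]
    exact (i1.add i2).congr he.symm
  · rw [integral_map hm.aemeasurable measurable_log_coe.aestronglyMeasurable,
      integral_congr_ae he, integral_add i1 i2, integral_fun_fst (f := fun y : ℝ≥0 => Real.log y),
      integral_fun_snd (f := fun y : ℝ≥0 => Real.log y)]
    simp

theorem HasLog.sum {ι : Type*} [Fintype ι] {μ : ι → Measure ℝ≥0} (h : ∀ i, HasLog (μ i)) :
    HasLog (∑ i, μ i) ∧
      ∫ y : ℝ≥0, Real.log y ∂(∑ i, μ i) = ∑ i, ∫ y : ℝ≥0, Real.log y ∂(μ i) := by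
  refine ⟨⟨?_, ?_⟩, ?_⟩
  · have h0 (i : ι) : (μ i) {y | ¬ y ≠ 0} = 0 := (h i).ae_ne_zero
    rw [ae_iff, Measure.finsetSum_apply, Finset.sum_eq_zero fun i _ => h0 i]
  · exact integrable_finsetSum_measure.2 fun i _ => (h i).integrable
  · exact integral_finsetSum_measure fun i _ => (h i).integrable

theorem hasLog_batchLaw_compose {X : Type*} [MeasurableSpace X] {n : ℕ}
    (W : ∀ k : Fin (n + 1), Kernel (Fin k → X) ℝ≥0)
    (M : ∀ k : Fin (n + 1), Kernel (Fin (n - k) → X) ℝ≥0)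
    [∀ k, IsFiniteKernel (W k)] [∀ k, IsMarkovKernel (M k)]
    (Q : Measure X) [IsProbabilityMeasure Q] (hW : ∀ k, HasLog (batchLaw (W k) Q))
    (hM : ∀ k, HasLog (batchLaw (M k) Q)) :
    HasLog (batchLaw (compose W M) Q) ∧
      ∫ y : ℝ≥0, Real.log y ∂(batchLaw (compose W M) Q) =
        ∑ k, (∫ y : ℝ≥0, Real.log y ∂(batchLaw (W k) Q) +
          (batchLaw (W k) Q).real Set.univ * ∫ y : ℝ≥0, Real.log y ∂(batchLaw (M k) Q)) := by
  rw [batchLaw_compose]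
  have := HasLog.sum fun k => ((hW k).map_mul (hM k)).1
  refine ⟨this.1, this.2.trans (Finset.sum_congr rfl fun k _ => ((hW k).map_mul (hM k)).2)⟩

/-- The stages of an algorithm that runs `M` on the first `m` points. -/
noncomputable def stageAt {X : Type*} [MeasurableSpace X] {m : ℕ} (M : Kernel (Fin m → X) ℝ≥0) (k : ℕ) :
    Kernel (Fin k → X) ℝ≥0 :=
  if h : m = k then h ▸ M else 0

theorem stageAt_self {X : Type*} [MeasurableSpace X] {m : ℕ} (M : Kernel (Fin m → X) ℝ≥0) :
    stageAt M m = M := by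
  simp [stageAt]

theorem stageAt_of_ne {X : Type*} [MeasurableSpace X] {m k : ℕ} (M : Kernel (Fin m → X) ℝ≥0)
    (h : m ≠ k) : stageAt M k = 0 := by
  simp [stageAt, h]

/-! ### The optimal expected logarithm -/

section Opt

variable {X : Type*} [MeasurableSpace X] (ε : ℝ) (P Q : Measure X)

/-- The finite values of `E^{Q^n}[log E]` for `ε`-DP e-variables `E` for `P`. -/
def logValues (n : ℕ) : Set ℝ :=
  {r | ∃ M : Kernel (Fin n → X) ℝ≥0, IsDPEVariable ε P M ∧ HasLog (batchLaw M Q) ∧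
    ∫ y : ℝ≥0, Real.log y ∂(batchLaw M Q) = r}

/-- The supremum of `E^{Q^n}[log E]` over `ε`-DP e-variables `E` for `P`. -/
noncomputable def optLog (n : ℕ) : ℝ := sSup (logValues ε P Q n)

variable [IsProbabilityMeasure P] [IsProbabilityMeasure Q] {ε}

theorem IsDPEVariable.lintegral_le {n : ℕ} {P : Measure X} [IsProbabilityMeasure P]
    {M : Kernel (Fin n → X) ℝ≥0} (h : IsDPEVariable ε P M) :
    ∫⁻ y, (y : ℝ≥0∞) ∂(batchLaw M Q) ≤ ENNReal.ofReal (Real.exp (n * ε)) := by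
  calc _ ≤ ∫⁻ y, (y : ℝ≥0∞) ∂(ENNReal.ofReal (Real.exp ε) ^ n • batchLaw M P) :=
        lintegral_mono' (h.dp.batchLaw_le P Q) le_rfl
    _ ≤ ENNReal.ofReal (Real.exp ε) ^ n * 1 := by
        rw [lintegral_smul_measure]
        exact mul_le_mul_right h.mean_le_one _
    _ = _ := by rw [mul_one, ← ENNReal.ofReal_pow (Real.exp_pos _).le, ← Real.exp_nat_mul]

theorem logValues_le {n : ℕ} {r : ℝ} (hr : r ∈ logValues ε P Q n) : r ≤ n * ε := by
  obtain ⟨M, hM, hL, rfl⟩ := hr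
  have := hM.markov
  exact hL.integral_le (hM.lintegral_le Q)

/-- Witnessed by the constant e-variable `1`. With the upper bound, this makes the `sSup` in
`optLog` a genuine supremum. -/
theorem zero_mem_logValues (hε : 0 ≤ ε) (n : ℕ) : 0 ∈ logValues ε P Q n := by
  have hl (P : Measure X) [IsProbabilityMeasure P] :
      batchLaw (Kernel.const (Fin n → X) (Measure.dirac (1 : ℝ≥0))) P = Measure.dirac 1 := by
    ext S hS
    rw [batchLaw, Measure.bind_apply hS (Kernel.aemeasurable _)]
    simp
  refine ⟨Kernel.const _ (Measure.dirac 1), ⟨inferInstance, isDP_const hε _, ?_⟩, ⟨?_, ?_⟩, ?_⟩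
  · simp [hl]
  · rw [hl, ae_dirac_eq]; exact one_ne_zero
  · rw [hl]; exact integrable_dirac (by simp)
  · rw [hl]; simp

theorem bddAbove_logValues (n : ℕ) : BddAbove (logValues ε P Q n) :=
  ⟨n * ε, fun _ => logValues_le P Q⟩

theorem optLog_nonneg (hε : 0 ≤ ε) (n : ℕ) : 0 ≤ optLog ε P Q n :=
  le_csSup (bddAbove_logValues P Q n) (zero_mem_logValues P Q hε n)

theorem optLog_le (hε : 0 ≤ ε) (n : ℕ) : optLog ε P Q n ≤ n * ε :=
  csSup_le ⟨0, zero_mem_logValues P Q hε n⟩ fun _ => logValues_le P Q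

theorem batchRate_eq (hε : 0 ≤ ε) {n : ℕ} (hn : n ≠ 0) :
    batchRate ε Q P n = ((optLog ε P Q n / n : ℝ) : EReal) := by
  have hn' : (0 : ℝ) < n := by positivity
  refine le_antisymm (iSup₂_le fun M hM => ?_) ?_
  · have := hM.markov
    rcases hasLog_or_expectedLog_eq_bot
      (ne_top_of_le_ne_top ENNReal.ofReal_ne_top (hM.lintegral_le Q)) with h | h
    · rw [h.expectedLog_eq, ← EReal.coe_div, EReal.coe_le_coe_iff]
      gcongr
      exact le_csSup (bddAbove_logValues P Q n) ⟨M, hM, h, rfl⟩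
    · rw [h, EReal.bot_div_of_pos_ne_top (by exact_mod_cast hn') (EReal.coe_ne_top _)]
      exact bot_le
  · refine EReal.le_of_forall_lt_iff_le.1 fun c hc => ?_
    rw [EReal.coe_le_coe_iff, div_le_iff₀ hn']
    refine csSup_le ⟨0, zero_mem_logValues P Q hε n⟩ ?_
    rintro _ ⟨M, hM, hL, rfl⟩
    have := (le_iSup₂_of_le M hM le_rfl).trans hc.le
    rwa [hL.expectedLog_eq, ← EReal.coe_div, EReal.coe_le_coe_iff, div_le_iff₀ hn'] at this

/-- Composing a family of stages with near-optimal e-variables for the remaining points. -/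
theorem le_optLog_of_stages (hε : 0 ≤ ε) {n : ℕ}
    (W : ∀ k : Fin (n + 1), Kernel (Fin k → X) ℝ≥0) [∀ k, IsFiniteKernel (W k)]
    (hdp : ∀ k, IsDP ε (W k)) (hW : ∀ x : Fin n → X, ∑ k, W k (cut k x).1 Set.univ = 1)
    (hP : ∑ k, ∫⁻ y, (y : ℝ≥0∞) ∂(batchLaw (W k) P) ≤ 1) (hQ : ∀ k, HasLog (batchLaw (W k) Q))
    (hmass : ∑ k, (batchLaw (W k) Q).real Set.univ = 1) :
    ∑ k, (∫ y : ℝ≥0, Real.log y ∂(batchLaw (W k) Q) +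
      (batchLaw (W k) Q).real Set.univ * optLog ε P Q (n - k)) ≤ optLog ε P Q n := by
  -- The suprema need not be attained. A loss of `δ` at each restart costs `δ` in total, since the
  -- stage masses sum to one.
  refine le_of_forall_pos_le_add fun δ hδ => ?_
  have hex (k : Fin (n + 1)) : ∃ r ∈ logValues ε P Q (n - k), optLog ε P Q (n - k) - δ < r :=
    exists_lt_of_lt_csSup ⟨0, zero_mem_logValues P Q hε _⟩ (by simp [optLog, hδ])
  choose r hr hlt using hex
  choose M hM hL hMr using hr
  have := fun k => (hM k).markov
  obtain ⟨h1, h2⟩ := hasLog_batchLaw_compose W M Q hQ hL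
  have hE : IsDPEVariable ε P (compose W M) :=
    ⟨isMarkovKernel_compose W M hW, isDP_compose W M hdp fun k => (hM k).dp,
      (lintegral_batchLaw_compose_le W M P fun k => (hM k).mean_le_one).trans hP⟩
  have h3 := le_csSup (bddAbove_logValues P Q n) ⟨_, hE, h1, rfl⟩
  rw [h2] at h3
  refine le_trans ?_ (add_le_add_left h3 δ)
  calc _ ≤ ∑ k, ((∫ y : ℝ≥0, Real.log y ∂(batchLaw (W k) Q) +
        (batchLaw (W k) Q).real Set.univ * ∫ y : ℝ≥0, Real.log y ∂(batchLaw (M k) Q)) +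
        (batchLaw (W k) Q).real Set.univ * δ) := by
        refine Finset.sum_le_sum fun k _ => ?_
        rw [add_assoc, ← mul_add, hMr k]
        gcongr
        linarith [hlt k]
    _ = _ := by rw [Finset.sum_add_distrib, ← Finset.sum_mul, hmass, one_mul]

/-- The case of a deterministic cut at `m`: all stages vanish except the one at `m`. -/
theorem optLog_add_le (hε : 0 ≤ ε) (m n : ℕ) :
    optLog ε P Q m + optLog ε P Q n ≤ optLog ε P Q (m + n) := by
  rw [← le_sub_iff_add_le]
  refine csSup_le ⟨0, zero_mem_logValues P Q hε m⟩ ?_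
  rintro _ ⟨M, hM, hL, rfl⟩
  rw [le_sub_iff_add_le]
  have := hM.markov
  set m' : Fin (m + n + 1) := ⟨m, by omega⟩
  have hne (k : Fin (m + n + 1)) (hk : k ≠ m') : stageAt M k = 0 :=
    stageAt_of_ne M fun h => hk (Fin.ext h.symm)
  have hself : stageAt M m' = M := stageAt_self M
  have hb0 (k : ℕ) (R : Measure X) : batchLaw (0 : Kernel (Fin k → X) ℝ≥0) R = 0 := by
    simp [batchLaw]
  have hfin (k : Fin (m + n + 1)) : IsFiniteKernel (stageAt M k) := by
    by_cases hk : k = m'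
    · subst hk; rw [hself]; infer_instance
    · rw [hne k hk]; infer_instance
  have key := le_optLog_of_stages P Q hε (fun k : Fin (m + n + 1) => stageAt M k) ?_ ?_ ?_ ?_ ?_
  · rw [Finset.sum_eq_single m'] at key
    · simpa [hself, m'] using key
    · intro k _ hk
      simp [hne k hk, hb0]
    · simp
  · intro k
    by_cases hk : k = m'
    · subst hk; rw [hself]; exact hM.dp
    · rw [hne k hk]; intro x x' _ S _; simp
  · intro x
    rw [Finset.sum_eq_single m']
    · rw [hself]; exact measure_univ
    · intro k _ hk
      simp [hne k hk]
    · simp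
  · rw [Finset.sum_eq_single m']
    · rw [hself]; exact hM.mean_le_one
    · intro k _ hk
      simp [hne k hk, hb0]
    · simp
  · intro k
    by_cases hk : k = m'
    · subst hk; rw [hself]; exact hL
    · rw [hne k hk, hb0]; exact ⟨by simp, by simp⟩
  · rw [Finset.sum_eq_single m']
    · rw [hself]; simp
    · intro k _ hk
      simp [hne k hk, hb0]
    · simp

theorem exists_tendsto_batchRate (hε : 0 ≤ ε) :
    ∃ R : ℝ, Tendsto (fun n : ℕ => batchRate ε Q P n) atTop (𝓝 (R : EReal)) ∧ 0 ≤ R ∧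
      Tendsto (fun n : ℕ => optLog ε P Q n / n) atTop (𝓝 R) := by
  have hsub : Subadditive fun n => -optLog ε P Q n := fun m n => by
    linarith [optLog_add_le P Q hε m n]
  have hb : BddBelow (Set.range fun n : ℕ => -optLog ε P Q n / n) := by
    refine ⟨-ε, ?_⟩
    rintro _ ⟨n, rfl⟩
    -- At `n = 0` the quotient is `0` by the convention for division by zero.
    rcases eq_or_ne n 0 with rfl | hn
    · simpa using hε
    · have : (0 : ℝ) < n := by positivity
      simp only
      rw [le_div_iff₀ this]
      linarith [optLog_le P Q hε n]
  have ht : Tendsto (fun n : ℕ => optLog ε P Q n / n) atTop (𝓝 (-hsub.lim)) := by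
    simpa [neg_div] using (hsub.tendsto_lim hb).neg
  refine ⟨-hsub.lim, ?_, ge_of_tendsto' ht fun n =>
    div_nonneg (optLog_nonneg P Q hε n) n.cast_nonneg, ht⟩
  refine (EReal.tendsto_coe.2 ht).congr' ?_
  filter_upwards [eventually_ne_atTop 0] with n hn using (batchRate_eq P Q hε hn).symm

end Opt

/-! ### The stages of a sequential test -/

/-- The final decision of a sequential test. -/
def decision (ω : (ℕ → Bool) × ℕ) : Bool := ω.1 ω.2

theorem measurable_decision : Measurable decision :=
  measurable_from_prod_countable_left fun k => measurable_pi_apply k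

/-- The event that the test stops at time `k` with a decision in `S`. -/
def stopsAt (k : ℕ) (S : Set Bool) : Set ((ℕ → Bool) × ℕ) := {ω | ω.2 = k ∧ decision ω ∈ S}

theorem measurableSet_stopsAt (k : ℕ) (S : Set Bool) : MeasurableSet (stopsAt k S) :=
  (measurable_snd (measurableSet_singleton k)).inter (measurable_decision (.of_discrete))

/-- `observed k` caps the stopping time at `k + 1`, so the value `k` is still seen faithfully. This
lets causality apply to the event of stopping at `k`. -/
theorem stopsAt_eq_preimage_observed (k : ℕ) (S : Set Bool) :
    stopsAt k S = observed k ⁻¹' {p | p.2 = k ∧ p.1 (Fin.last k) ∈ S} := by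
  ext ⟨φ, N⟩
  simp only [stopsAt, decision, observed, Set.mem_ofPred_eq, Set.mem_preimage, Fin.val_last]
  constructor
  · rintro ⟨rfl, h⟩; simp [h]
  · rintro ⟨h1, h2⟩
    obtain rfl : N = k := by omega
    exact ⟨rfl, h2⟩

/-- Extend a sample to a stream by repeating the point `x₀`. -/
def pad {X : Type*} (x₀ : X) (k : ℕ) (x : Fin k → X) : ℕ → X :=
  fun i => if h : i < k then x ⟨i, h⟩ else x₀

section Stage

variable {X : Type*} [MeasurableSpace X]

theorem measurable_pad (x₀ : X) (k : ℕ) : Measurable (pad x₀ k) := by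
  refine measurable_pi_iff.2 fun i => ?_
  by_cases h : i < k
  · simpa [pad, h] using measurable_pi_apply _
  · simp [pad, h]

theorem IsDPSequentialTest.apply_stopsAt_congr {ε : ℝ} {M : Kernel (ℕ → X) ((ℕ → Bool) × ℕ)}
    (hM : IsDPSequentialTest ε M) {k : ℕ} {x x' : ℕ → X} (h : ∀ i, i < k → x i = x' i)
    (S : Set Bool) : M x (stopsAt k S) = M x' (stopsAt k S) := by
  have hm : MeasurableSet {p : (Fin (k + 1) → Bool) × ℕ | p.2 = k ∧ p.1 (Fin.last k) ∈ S} :=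
    .of_discrete
  rw [stopsAt_eq_preimage_observed, ← Measure.map_apply (measurable_observed k) hm,
    ← Measure.map_apply (measurable_observed k) hm, hM.causal k x x' h]

/-- The law of the decision on the event that the test stops at time `k`, as a function of the
first `k` data points. -/
noncomputable def testStage (x₀ : X) (M : Kernel (ℕ → X) ((ℕ → Bool) × ℕ)) (k : ℕ) :
    Kernel (Fin k → X) Bool :=
  ((M.restrict (measurableSet_stopsAt k Set.univ)).map decision).comap (pad x₀ k)
    (measurable_pad x₀ k)

variable {x₀ : X} {M : Kernel (ℕ → X) ((ℕ → Bool) × ℕ)} {ε : ℝ}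

instance [IsFiniteKernel M] (k : ℕ) : IsFiniteKernel (testStage x₀ M k) := by
  unfold testStage; infer_instance

theorem testStage_apply (k : ℕ) (x : Fin k → X) (S : Set Bool) :
    testStage x₀ M k x S = M (pad x₀ k x) (stopsAt k S) := by
  rw [testStage, Kernel.comap_apply, Kernel.map_apply' _ measurable_decision _ .of_discrete,
    Kernel.restrict_apply' _ _ _ (measurable_decision .of_discrete)]
  congr 1
  ext ω
  simp [stopsAt, and_comm]

theorem IsDPSequentialTest.isDP_testStage (hM : IsDPSequentialTest ε M) (k : ℕ) :
    IsDP ε (testStage x₀ M k) := by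
  rintro x x' ⟨i, hi⟩ S -
  rw [testStage_apply, testStage_apply]
  refine hM.dp _ _ ⟨i, fun j hj => ?_⟩ _ (measurableSet_stopsAt k S)
  by_cases h : j < k
  · simpa [pad, h] using hi ⟨j, h⟩ fun e => hj (congrArg Fin.val e)
  · simp [pad, h]

theorem map_infinitePi_fin (P : Measure X) [IsProbabilityMeasure P] (k : ℕ) :
    (Measure.infinitePi fun _ : ℕ => P).map (fun x (i : Fin k) => x i) =
      Measure.pi fun _ : Fin k => P := by
  symm
  refine Measure.pi_eq fun s hs => ?_
  rw [Measure.map_apply (by fun_prop) (.univ_pi hs)]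
  have : (fun (x : ℕ → X) (i : Fin k) => x i) ⁻¹' Set.univ.pi s =
      Set.pi ((Finset.univ : Finset (Fin k)).map Fin.valEmbedding : Finset ℕ)
        fun i => if h : i < k then s ⟨i, h⟩ else Set.univ := by
    ext x
    simp only [Set.mem_preimage, Set.mem_pi, Set.mem_univ, true_imp_iff, Finset.mem_coe,
      Finset.mem_map, Finset.mem_univ, true_and, forall_exists_index, forall_apply_eq_imp_iff,
      Fin.valEmbedding_apply, Fin.is_lt, dite_true]
  rw [this, Measure.infinitePi_pi]
  · simp only [Finset.prod_map, Fin.valEmbedding_apply, Fin.is_lt, dite_true]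
  · intro i _
    split_ifs
    · exact hs _
    · exact .univ

/-- By causality the padding can be replaced by the true continuation of the stream. -/
theorem IsDPSequentialTest.batchLaw_testStage (hM : IsDPSequentialTest ε M) (P : Measure X)
    [IsProbabilityMeasure P] (k : ℕ) (S : Set Bool) :
    batchLaw (testStage x₀ M k) P S = streamLaw M P (stopsAt k S) := by
  rw [batchLaw, streamLaw, Measure.bind_apply .of_discrete (Kernel.aemeasurable _),
    Measure.bind_apply (measurableSet_stopsAt k S) (Kernel.aemeasurable _), ← map_infinitePi_fin,
    lintegral_map ((testStage x₀ M k).measurable_coe .of_discrete) (by fun_prop)]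
  refine lintegral_congr fun x => ?_
  rw [testStage_apply]
  exact hM.apply_stopsAt_congr (fun i hi => by simp [pad, hi]) S

theorem sum_measure_stopsAt {μ : Measure ((ℕ → Bool) × ℕ)} {n : ℕ} (h : ∀ᵐ ω ∂μ, ω.2 ≤ n)
    (S : Set Bool) : ∑ k : Fin (n + 1), μ (stopsAt k S) = μ (decision ⁻¹' S) := by
  rw [← tsum_fintype (L := .unconditional _), ← measure_iUnion _ fun k : Fin (n + 1) => measurableSet_stopsAt k S]
  · refine measure_congr ?_
    filter_upwards [h] with ω hω
    refine propext ⟨fun hs => ?_, fun hs => ?_⟩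
    · obtain ⟨k, hk⟩ := Set.mem_iUnion.1 hs
      exact hk.2
    · exact Set.mem_iUnion.2 ⟨⟨ω.2, by omega⟩, rfl, hs⟩
  · intro k l hkl
    refine Set.disjoint_left.2 fun ω hk hl => hkl (Fin.ext (hk.1.symm.trans hl.1))

theorem integral_stoppingTime {μ : Measure ((ℕ → Bool) × ℕ)} [IsFiniteMeasure μ] {n : ℕ}
    (h : ∀ᵐ ω ∂μ, ω.2 ≤ n) :
    ∫ ω, (ω.2 : ℝ) ∂μ = ∑ k ∈ Finset.range (n + 1), μ.real (stopsAt k Set.univ) * k := by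
  have he : (fun ω : (ℕ → Bool) × ℕ => (ω.2 : ℝ)) =ᵐ[μ]
      fun ω => ∑ k ∈ Finset.range (n + 1), (stopsAt k Set.univ).indicator (fun _ => (k : ℝ)) ω := by
    filter_upwards [h] with ω hω
    rw [Finset.sum_eq_single ω.2]
    · simp [stopsAt]
    · intro k _ hk
      simp [stopsAt, hk.symm]
    · simp; omega
  rw [integral_congr_ae he, integral_finsetSum _ fun k _ =>
    (integrable_const _).indicator (measurableSet_stopsAt k _)]
  refine Finset.sum_congr rfl fun k _ => ?_
  rw [integral_indicator_const _ (measurableSet_stopsAt k _), smul_eq_mul]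

theorem ae_streamLaw {p : (ℕ → Bool) × ℕ → Prop} (h : ∀ x, ∀ᵐ ω ∂(M x), p ω)
    (hp : MeasurableSet {ω | p ω}) (P : Measure X) : ∀ᵐ ω ∂(streamLaw M P), p ω := by
  rw [ae_iff, streamLaw]
  refine (Measure.bind_apply hp.compl (Kernel.aemeasurable _)).trans ?_
  exact (lintegral_congr fun x => h x).trans lintegral_zero

theorem batchLaw_map {O O' : Type*} [MeasurableSpace O] [MeasurableSpace O'] {k : ℕ}
    (V : Kernel (Fin k → X) O) {L : O → O'} (hL : Measurable L) (P : Measure X) :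
    batchLaw (V.map L) P = (batchLaw V P).map L := by
  ext S hS
  rw [Measure.map_apply hL hS, batchLaw, batchLaw, Measure.bind_apply hS (Kernel.aemeasurable _),
    Measure.bind_apply (hL hS) (Kernel.aemeasurable _)]
  exact lintegral_congr fun x => Kernel.map_apply' _ hL _ hS

theorem IsDP.map {O O' : Type*} [MeasurableSpace O] [MeasurableSpace O'] {ι : Type*}
    {V : Kernel (ι → X) O} (hV : IsDP ε V) {L : O → O'} (hL : Measurable L) :
    IsDP ε (V.map L) := by
  intro x x' h S hS
  rw [Kernel.map_apply' _ hL _ hS, Kernel.map_apply' _ hL _ hS]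
  exact hV x x' h _ (hL hS)

/-- The law of the final decision, decomposed according to the stopping time. -/
theorem IsDPSequentialTest.sum_batchLaw_testStage (hM : IsDPSequentialTest ε M) (P : Measure X)
    [IsProbabilityMeasure P] {n : ℕ} (h : ∀ᵐ ω ∂(streamLaw M P), ω.2 ≤ n) :
    ∑ k : Fin (n + 1), batchLaw (testStage x₀ M k) P = (streamLaw M P).map decision := by
  ext S hS
  rw [Measure.finsetSum_apply, Measure.map_apply measurable_decision hS, ← sum_measure_stopsAt h]
  exact Finset.sum_congr rfl fun k _ => hM.batchLaw_testStage P k S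

/-- Group privacy applies to each of the finitely many stages. This excludes an infinite divergence
between the decision laws. -/
theorem IsDPSequentialTest.absolutelyContinuous (hM : IsDPSequentialTest ε M) (P Q : Measure X)
    [IsProbabilityMeasure P] [IsProbabilityMeasure Q] {n : ℕ} (h : ∀ x, ∀ᵐ ω ∂(M x), ω.2 ≤ n) :
    (streamLaw M Q).map decision ≪ (streamLaw M P).map decision := by
  obtain ⟨x₀⟩ := nonempty_of_isProbabilityMeasure P
  have hN := ae_streamLaw h (measurable_snd measurableSet_Iic)
  rw [← hM.sum_batchLaw_testStage (x₀ := x₀) P (hN P),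
    ← hM.sum_batchLaw_testStage (x₀ := x₀) Q (hN Q)]
  intro S hS
  rw [Measure.finsetSum_apply, Finset.sum_eq_zero_iff] at hS ⊢
  intro k hk
  have := (hM.isDP_testStage (x₀ := x₀) k).batchLaw_le P Q S
  simpa [hS k hk] using this

/-- Bet on the final decision of the test with stakes `L`, then restart on the remaining points. -/
theorem IsDPSequentialTest.renewal_le (hM : IsDPSequentialTest ε M) (hε : 0 ≤ ε)
    (P Q : Measure X) [IsProbabilityMeasure P] [IsProbabilityMeasure Q] {n : ℕ}
    (h : ∀ x, ∀ᵐ ω ∂(M x), ω.2 ≤ n) (L : Bool → ℝ≥0)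
    (hP : ∫⁻ b, (L b : ℝ≥0∞) ∂((streamLaw M P).map decision) ≤ 1)
    (hQ : ∀ᵐ b ∂((streamLaw M Q).map decision), L b ≠ 0) :
    ∫ b, Real.log (L b) ∂((streamLaw M Q).map decision) +
      ∑ k ∈ Finset.range (n + 1),
        (streamLaw M Q).real (stopsAt k Set.univ) * optLog ε P Q (n - k) ≤ optLog ε P Q n := by
  obtain ⟨x₀⟩ := nonempty_of_isProbabilityMeasure P
  have := hM.markov
  have hL : Measurable L := .of_discrete
  have hN := ae_streamLaw h (measurable_snd measurableSet_Iic)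
  have hsP := hM.sum_batchLaw_testStage (x₀ := x₀) P (hN P)
  have hsQ := hM.sum_batchLaw_testStage (x₀ := x₀) Q (hN Q)
  have hW (k : Fin (n + 1)) : IsFiniteKernel ((testStage x₀ M k).map L) :=
    Kernel.IsFiniteKernel.map _ L
  have hmass (k : Fin (n + 1)) : (batchLaw ((testStage x₀ M k).map L) Q).real Set.univ =
      (streamLaw M Q).real (stopsAt k Set.univ) := by
    rw [batchLaw_map _ hL, Measure.real, Measure.map_apply hL .univ, Set.preimage_univ,
      hM.batchLaw_testStage, Measure.real]
  have : IsProbabilityMeasure (streamLaw M Q) := by unfold streamLaw; infer_instance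
  have key := le_optLog_of_stages P Q hε (fun k : Fin (n + 1) => (testStage x₀ M k).map L)
    (fun k => (hM.isDP_testStage k).map hL) ?_ ?_ ?_ ?_
  · simp_rw [Finset.sum_add_distrib, hmass] at key
    rw [← Fin.sum_univ_eq_sum_range fun k =>
      (streamLaw M Q).real (stopsAt k Set.univ) * optLog ε P Q (n - k)]
    refine le_trans (le_of_eq ?_) key
    congr 1
    rw [← hsQ, integral_finsetSum_measure fun k _ => .of_finite]
    refine Finset.sum_congr rfl fun k _ => ?_
    rw [batchLaw_map _ hL, integral_map hL.aemeasurable measurable_log_coe.aestronglyMeasurable]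
  · intro x
    have hx (k : Fin (n + 1)) : (testStage x₀ M k).map L (cut k x).1 Set.univ =
        M (pad x₀ n x) (stopsAt k Set.univ) := by
      rw [Kernel.map_apply' _ hL _ .univ, Set.preimage_univ, testStage_apply]
      -- By causality all stages can be evaluated on one common stream, where the stopping
      -- probabilities sum to one.
      refine hM.apply_stopsAt_congr (fun i hi => ?_) _
      have hin : i < n := by omega
      simp only [pad, hi, hin, dite_true, cut]
      exact congrArg x (Fin.ext (cutEquiv_inl k _))
    simp_rw [hx]
    rw [sum_measure_stopsAt (h _), Set.preimage_univ, measure_univ]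
  · refine le_trans (le_of_eq ?_) hP
    rw [← hsP, lintegral_finsetSum_measure]
    refine Finset.sum_congr rfl fun k _ => ?_
    rw [batchLaw_map _ hL, lintegral_map (by fun_prop) hL]
  · intro k
    rw [batchLaw_map _ hL]
    refine ⟨(ae_map_iff hL.aemeasurable (measurableSet_singleton 0).compl).2 ?_, ?_⟩
    · refine ae_mono ?_ hQ
      rw [← hsQ]
      exact Finset.single_le_sum (f := fun k : Fin (n + 1) => batchLaw (testStage x₀ M k) Q)
        (fun _ _ => Measure.zero_le _) (Finset.mem_univ k)
    · rw [integrable_map_measure measurable_log_coe.aestronglyMeasurable hL.aemeasurable]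
      exact .of_finite
  · simp_rw [hmass, Measure.real]
    rw [← ENNReal.toReal_sum fun _ _ => measure_ne_top _ _, sum_measure_stopsAt (hN Q),
      Set.preimage_univ, measure_univ, ENNReal.toReal_one]

end Stage

/-! ### A renewal inequality -/

theorem le_mul_of_renewal {a q : ℕ → ℝ} {R D m : ℝ} {N : ℕ} (ha : ∀ n, 0 ≤ a n)
    (hq : ∀ k, 0 ≤ q k) (hR : 0 ≤ R) (hm : 0 ≤ m)
    (hlim : Tendsto (fun n : ℕ => a n / n) atTop (𝓝 R))
    (hsum : ∀ n, N ≤ n → ∑ k ∈ Finset.range (n + 1), q k = 1)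
    (hmean : ∀ n, N ≤ n → ∑ k ∈ Finset.range (n + 1), q k * k = m)
    (hrec : ∀ n, N ≤ n → D + ∑ k ∈ Finset.range (n + 1), q k * a (n - k) ≤ a n) :
    D ≤ m * R := by
  rcases le_or_gt D 0 with hD | hD
  · exact hD.trans (mul_nonneg hm hR)
  -- Stopping at time `0` almost surely would give `D + a N ≤ a N`.
  have hq0 : q 0 < 1 := by
    by_contra! h
    have h1 := hrec N le_rfl
    rw [Finset.sum_range_succ'] at h1
    have h2 : 0 ≤ ∑ k ∈ Finset.range N, q (k + 1) * a (N - (k + 1)) :=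
      Finset.sum_nonneg fun k _ => mul_nonneg (hq _) (ha _)
    have h3 : 1 * a N ≤ q 0 * a N := mul_le_mul_of_nonneg_right h (ha N)
    simp only [Nat.sub_zero] at h1
    linarith
  -- The offset `N` makes the bound trivial below `N`, where the recursion is not available.
  have claim (c : ℝ) (hc : 0 ≤ c) (hcD : c * m ≤ D) (n : ℕ) : c * (n - N) ≤ a n := by
    induction n using Nat.strong_induction_on with
    | _ n ih =>
      rcases lt_or_ge n N with hn | hn
      · have : (n : ℝ) ≤ N := by exact_mod_cast hn.le
        exact (mul_nonpos_of_nonneg_of_nonpos hc (by linarith)).trans (ha n)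
      · have h1 := hrec n hn
        have h2 : ∑ k ∈ Finset.range (n + 1), q k * (a (n - k) - c * (((n - k : ℕ) : ℝ) - N)) =
            ∑ k ∈ Finset.range (n + 1), q k * a (n - k) - c * (n - N) + c * m := by
          rw [← hmean n hn, ← mul_one (c * (n - N) : ℝ), ← hsum n hn, Finset.mul_sum,
            Finset.mul_sum, ← Finset.sum_sub_distrib, ← Finset.sum_add_distrib]
          refine Finset.sum_congr rfl fun k hk => ?_
          rw [Nat.cast_sub (Finset.mem_range_succ_iff.1 hk)]
          ring
        -- The term `k = 0` contains `a n` itself, outside the induction hypothesis; it is kept and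
        -- absorbed using `q 0 < 1`.
        have h3 : q 0 * (a n - c * (n - N)) ≤
            ∑ k ∈ Finset.range (n + 1), q k * (a (n - k) - c * (((n - k : ℕ) : ℝ) - N)) := by
          rw [Finset.sum_range_succ', Nat.sub_zero]
          refine le_add_of_nonneg_left (Finset.sum_nonneg fun k hk => ?_)
          refine mul_nonneg (hq _) (sub_nonneg.2 (ih _ ?_))
          have := Finset.mem_range.1 hk
          omega
        have h4 : 0 ≤ (1 - q 0) * (a n - c * (n - N)) := by linarith
        linarith [nonneg_of_mul_nonneg_right h4 (by linarith)]
  have hcR (c : ℝ) (hc : 0 ≤ c) (hcD : c * m ≤ D) : c ≤ R := by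
    have hl : Tendsto (fun n : ℕ => c - c * N / n) atTop (𝓝 (c - 0)) :=
      tendsto_const_nhds.sub (tendsto_const_div_atTop_nhds_zero_nat _)
    rw [sub_zero] at hl
    refine le_of_tendsto_of_tendsto hl hlim ?_
    filter_upwards [eventually_gt_atTop 0] with n hn
    have hn' : (0 : ℝ) < n := by exact_mod_cast hn
    rw [le_div_iff₀ hn', sub_mul, div_mul_cancel₀ _ hn'.ne']
    linarith [claim c hc hcD n]
  -- If `m = 0`, every slope `c ≥ 0` is admissible, which contradicts the finiteness of `R`.
  rcases hm.eq_or_lt with rfl | hm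
  · have := hcR (R + 1) (by linarith) (by simpa using hD.le)
    linarith
  · have := hcR (D / m) (div_nonneg hD.le hm.le) (by rw [div_mul_cancel₀ _ hm.ne'])
    rw [div_le_iff₀ hm] at this
    linarith

end DPTest

/-! ### The lower bound on the expected stopping time -/

theorem mainTheorem8 {X : Type*} [MeasurableSpace X] (P Q : Measure X)
    [IsProbabilityMeasure P] [IsProbabilityMeasure Q] (ε : ℝ) (hε : 0 ≤ ε)
    (M : Kernel (ℕ → X) ((ℕ → Bool) × ℕ)) (hM : DPTest.IsDPSequentialTest ε M)
    (Nmax : ℕ) (hN : ∀ x, ∀ᵐ ω ∂(M x), ω.2 < Nmax)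
    (α β : ℝ)
    (hα : (DPTest.streamLaw M P).real DPTest.rejects = α)
    (hβ : (DPTest.streamLaw M Q).real DPTest.rejects = 1 - β) :
    ∃ R : ℝ, Tendsto (fun n : ℕ => DPTest.batchRate ε Q P n) atTop (𝓝 (R : EReal)) ∧ 0 ≤ R ∧
      (1 - β) * Real.log ((1 - β) / α) + β * Real.log (β / (1 - α)) ≤
        (∫ ω, (ω.2 : ℝ) ∂(DPTest.streamLaw M Q)) * R ∧
      ((1 - β) * Real.log ((1 - β) / α) + β * Real.log (β / (1 - α))) / R ≤
        ∫ ω, (ω.2 : ℝ) ∂(DPTest.streamLaw M Q) := by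
  have := hM.markov
  obtain ⟨R, hR, hR0, hlim⟩ := DPTest.exists_tendsto_batchRate P Q hε
  have hm : 0 ≤ ∫ ω, (ω.2 : ℝ) ∂(DPTest.streamLaw M Q) := integral_nonneg fun ω => by positivity
  suffices hmain : (1 - β) * Real.log ((1 - β) / α) + β * Real.log (β / (1 - α)) ≤
      (∫ ω, (ω.2 : ℝ) ∂(DPTest.streamLaw M Q)) * R from
    ⟨R, hR, hR0, hmain, div_le_of_le_mul₀ hR0 hm hmain⟩
  have hle (n : ℕ) (hn : Nmax ≤ n) (x) : ∀ᵐ ω ∂(M x), ω.2 ≤ n :=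
    (hN x).mono fun ω h => h.le.trans hn
  have prob (R : Measure X) [IsProbabilityMeasure R] :
      IsProbabilityMeasure (DPTest.streamLaw M R) := by
    unfold DPTest.streamLaw; infer_instance
  have pP := prob P
  have pQ := prob Q
  have prob' (R : Measure X) [IsProbabilityMeasure R] :
      IsProbabilityMeasure ((DPTest.streamLaw M R).map DPTest.decision) :=
    Measure.isProbabilityMeasure_map DPTest.measurable_decision.aemeasurable
  have pP' := prob' P
  have pQ' := prob' Q
  have htrue (R : Measure X) : ((DPTest.streamLaw M R).map DPTest.decision).real {true} =
      (DPTest.streamLaw M R).real DPTest.rejects := by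
    rw [Measure.real, Measure.map_apply DPTest.measurable_decision .of_discrete]
    rfl
  have hfalse (R : Measure X) [IsProbabilityMeasure R] :
      ((DPTest.streamLaw M R).map DPTest.decision).real {false} =
        1 - (DPTest.streamLaw M R).real DPTest.rejects := by
    have := prob' R
    rw [← htrue, ← probReal_compl_eq_one_sub .of_discrete]
    congr 1
    ext b; simp
  have tP := htrue P
  have tQ := htrue Q
  have fP := hfalse P
  have fQ := hfalse Q
  rw [hα] at tP fP
  rw [hβ] at tQ fQ
  rw [sub_sub_cancel] at fQ
  have hac := hM.absolutelyContinuous P Q (hle Nmax le_rfl)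
  have hac' (b : Bool) (h : ((DPTest.streamLaw M P).map DPTest.decision).real {b} = 0) :
      ((DPTest.streamLaw M Q).map DPTest.decision).real {b} = 0 := by
    rw [measureReal_eq_zero_iff] at h ⊢
    exact hac h
  have hα0 : 0 ≤ α := tP ▸ measureReal_nonneg
  have hα1 : 0 ≤ 1 - α := fP ▸ measureReal_nonneg
  have hβ0 : 0 ≤ β := fQ ▸ measureReal_nonneg
  have hβ1 : 0 ≤ 1 - β := tQ ▸ measureReal_nonneg
  -- If `α` is `0` or `1`, absolute continuity forces the decision to have the same deterministic
  -- value under `Q`, and the left-hand side is `0`.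
  rcases hα0.eq_or_lt with h0 | h0
  · have h1 : 1 - β = 0 := tQ ▸ hac' true (tP.trans h0.symm)
    obtain rfl : β = 1 := by linarith
    simpa [← h0] using mul_nonneg hm hR0
  rcases hα1.eq_or_lt with h1 | h1
  · have h2 : β = 0 := fQ ▸ hac' false (fP.trans h1.symm)
    obtain rfl : α = 1 := by linarith
    simpa [h2] using mul_nonneg hm hR0
  -- The likelihood ratio of the decision: its mean under `P` is `1`, and its expected log under `Q`
  -- is the divergence.
  let L : Bool → ℝ≥0 := fun b =>
    if b then ((1 - β) / α).toNNReal else (β / (1 - α)).toNNReal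
  have hLt : (L true : ℝ) = (1 - β) / α := Real.coe_toNNReal _ (by positivity)
  have hLf : (L false : ℝ) = β / (1 - α) := Real.coe_toNNReal _ (by positivity)
  have hLP : ∫⁻ b, (L b : ℝ≥0∞) ∂((DPTest.streamLaw M P).map DPTest.decision) ≤ 1 := by
    rw [lintegral_fintype, Fintype.sum_bool, ← ofReal_measureReal, ← ofReal_measureReal, tP, fP,
      ← ENNReal.ofReal_coe_nnreal, ← ENNReal.ofReal_coe_nnreal, hLt, hLf,
      ← ENNReal.ofReal_mul (by positivity), ← ENNReal.ofReal_mul (by positivity),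
      ← ENNReal.ofReal_add (by positivity) (by positivity), div_mul_cancel₀ _ h0.ne',
      div_mul_cancel₀ _ h1.ne']
    simp
  -- A stake vanishes only on a decision of probability zero under `Q`.
  have hLQ : ∀ᵐ b ∂((DPTest.streamLaw M Q).map DPTest.decision), L b ≠ 0 := by
    rw [ae_iff_of_countable]
    intro b hb h
    have hb' : ((DPTest.streamLaw M Q).map DPTest.decision).real {b} ≠ 0 := by
      rwa [Ne, measureReal_eq_zero_iff]
    have h' : (L b : ℝ) = 0 := by simp [h]
    cases b
    · rw [hLf, div_eq_zero_iff] at h'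
      exact hb' (fQ.trans (h'.resolve_right h1.ne'))
    · rw [hLt, div_eq_zero_iff] at h'
      exact hb' (tQ.trans (h'.resolve_right h0.ne'))
  have hD : ∫ b, Real.log (L b) ∂((DPTest.streamLaw M Q).map DPTest.decision) =
      (1 - β) * Real.log ((1 - β) / α) + β * Real.log (β / (1 - α)) := by
    rw [integral_fintype .of_finite, Fintype.sum_bool, tQ, fQ, hLt, hLf, smul_eq_mul, smul_eq_mul]
  have hleQ (n : ℕ) (hn : Nmax ≤ n) : ∀ᵐ ω ∂(DPTest.streamLaw M Q), ω.2 ≤ n :=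
    DPTest.ae_streamLaw (hle n hn) (measurable_snd measurableSet_Iic) Q
  refine DPTest.le_mul_of_renewal (N := Nmax) (DPTest.optLog_nonneg P Q hε)
    (fun _ => measureReal_nonneg) hR0 hm hlim (fun n hn => ?_)
    (fun n hn => (DPTest.integral_stoppingTime (hleQ n hn)).symm) fun n hn => ?_
  · simp_rw [Measure.real]
    rw [← ENNReal.toReal_sum fun _ _ => measure_ne_top _ _, ← Fin.sum_univ_eq_sum_range fun k =>
      DPTest.streamLaw M Q (DPTest.stopsAt k Set.univ), DPTest.sum_measure_stopsAt (hleQ n hn),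
      Set.preimage_univ, measure_univ, ENNReal.toReal_one]
  · rw [← hD]
    exact hM.renewal_le hε P Q (hle n hn) L hLP hLQ
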